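/- Let $D$ and $E$ be (not necessarily unital) C*-algebras and let $\phi : D \to E$ be a *-homomorphism. For a C*-algebra $A$, let $\mathcal I(A)$ be the complete lattice of closed two-sided ideals of $A$, ordered by inclusion (infima are intersections, suprema are norm closures of algebraic sums), and for $a \in A$ let $\mathrm{Ideal}(a)$ be the smallest closed two-sided ideal of $A$ containing $a$. An element $a$ is full in a C*-algebra $B$ if $a\in B$ and $B$ is the only closed two-sided ideal of $B$ that contains $a$. Let $X = \mathrm{Prim}(E)$ be the space of primitive ideals of $E$ (kernels of nonzero irreducible *-representations on Hilbert spaces) with the hull-kernel topology, and let $\mathcal O(X)$ be the complete lattice of its open subsets, ordered by inclusion (the infimum of a family is the interior of its intersection, the supremum is its union). Define order preserving maps $$\Phi_E : \mathcal O(X) \to \mathcal I(E),\quad \Phi_E(G) = \bigcap_{J \in X \setminus G} J, \qquad \Phi_D : \mathcal O(X) \to \mathcal I(D),\quad \Phi_D(G) = \phi^{-1}(\Phi_E(G)),$$ where the empty intersection is $E$. Write $D(U) = \Phi_D(U)$ and $E(U) = \Phi_E(U)$. A *-homomorphism $\psi : D \to E$ is called $X$-equivariant if $\psi(D(U)) \subseteq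 E(U)$ for every $U \in \mathcal O(X)$. It is called $X$-full if for every $d \in D$ there is a smallest $U_d \in \mathcal O(X)$ with $d \in D(U_d)$, and $\psi(d)$ is full in $E(U_d)$. Then: 1. $\Phi_E$ is an order isomorphism of $\mathcal O(X)$ onto $\mathcal I(E)$. 2. $\Phi_D$ preserves infima of arbitrary subsets of $\mathcal O(X)$. If, additionally, $\mathcal O(X)$ is finite, then $\Phi_D$ preserves suprema of nonempty increasing nets in $\mathcal O(X)$. 3. For every $d \in D$ there is a smallest open subset $U_d \subseteq X$ with $d \in D(U_d)$. 4. The *-homomorphism $\phi$ is $X$-equivariant and $X$-full. 5. For every *-homomorphism $\psi : D \to E$, one has $\mathrm{Ideal}(\psi(a)) = \mathrm{Ideal}(\phi(a))$ for all $a \in D$ if and only if $\psi$ is $X$-equivariant and $X$-full (with respect to the same maps $\Phi_D$ and $\Phi_E$, defined from $\phi$). -/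

import Mathlib

open TopologicalSpace

namespace CStarX

universe u v

/-- A closed two-sided ideal of a (not necessarily unital) C*-algebra. -/
structure ClosedIdeal (A : Type u) [NonUnitalCStarAlgebra A] extends Submodule ℂ A where
  mul_mem_left' : ∀ (a : A) {x : A}, x ∈ carrier → a * x ∈ carrier
  mul_mem_right' : ∀ (a : A) {x : A}, x ∈ carrier → x * a ∈ carrier
  isClosed' : IsClosed carrier

namespace ClosedIdeal

variable {A : Type u} [NonUnitalCStarAlgebra A]

instance : SetLike (ClosedIdeal A) A where
  coe I := I.carrier
  coe_injective I J h := by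
    obtain ⟨I, _, _, _⟩ := I
    obtain ⟨J, _, _, _⟩ := J
    have : I = J := SetLike.coe_injective h
    subst this
    rfl

/-- Closed ideals are ordered by inclusion. -/
instance : PartialOrder (ClosedIdeal A) := .ofSetLike (ClosedIdeal A) A

theorem le_iff {I J : ClosedIdeal A} : I ≤ J ↔ ∀ x ∈ I, x ∈ J := Iff.rfl

theorem mem_toSubmodule {I : ClosedIdeal A} {x : A} : x ∈ I.toSubmodule ↔ x ∈ I := Iff.rfl

theorem mul_mem_left (I : ClosedIdeal A) (a : A) {x : A} (hx : x ∈ I) : a * x ∈ I :=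
  I.mul_mem_left' a hx

theorem mul_mem_right (I : ClosedIdeal A) (a : A) {x : A} (hx : x ∈ I) : x * a ∈ I :=
  I.mul_mem_right' a hx

theorem isClosed (I : ClosedIdeal A) : IsClosed (I : Set A) := I.isClosed'

/-- The infimum of a collection of closed ideals is their intersection. -/
instance : InfSet (ClosedIdeal A) where
  sInf S :=
    { carrier := ⋂ I ∈ S, (I : Set A)
      zero_mem' := Set.mem_iInter₂.2 fun I _ => I.toSubmodule.zero_mem
      add_mem' := fun hx hy => Set.mem_iInter₂.2 fun I hI =>
        I.toSubmodule.add_mem (Set.mem_iInter₂.1 hx I hI) (Set.mem_iInter₂.1 hy I hI)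
      smul_mem' := fun c _ hx => Set.mem_iInter₂.2 fun I hI =>
        I.toSubmodule.smul_mem c (Set.mem_iInter₂.1 hx I hI)
      mul_mem_left' := fun a _ hx => Set.mem_iInter₂.2 fun I hI =>
        I.mul_mem_left a (Set.mem_iInter₂.1 hx I hI)
      mul_mem_right' := fun a _ hx => Set.mem_iInter₂.2 fun I hI =>
        I.mul_mem_right a (Set.mem_iInter₂.1 hx I hI)
      isClosed' := isClosed_biInter fun I _ => I.isClosed }

theorem mem_sInf {S : Set (ClosedIdeal A)} {x : A} : x ∈ sInf S ↔ ∀ I ∈ S, x ∈ I :=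
  Set.mem_iInter₂

theorem mul_mem_closure_left (N : Submodule ℂ A) (a : A)
    (h : ∀ x ∈ N, a * x ∈ N) {x : A} (hx : x ∈ N.topologicalClosure) :
    a * x ∈ N.topologicalClosure :=
  map_mem_closure (continuous_const_mul a) hx h

theorem mul_mem_closure_right (N : Submodule ℂ A) (a : A)
    (h : ∀ x ∈ N, x * a ∈ N) {x : A} (hx : x ∈ N.topologicalClosure) :
    x * a ∈ N.topologicalClosure :=
  map_mem_closure (f := fun y => y * a) (continuous_mul_const a) hx h

/-- The supremum of a collection of closed ideals is the norm closure of their algebraic sum. -/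
instance : SupSet (ClosedIdeal A) where
  sSup S :=
    { (⨆ I ∈ S, I.toSubmodule : Submodule ℂ A).topologicalClosure with
      mul_mem_left' := fun a {x} hx => by
        refine mul_mem_closure_left _ a (fun y hy => ?_) hx
        have : (⨆ I ∈ S, I.toSubmodule : Submodule ℂ A) ≤
            (⨆ I ∈ S, I.toSubmodule : Submodule ℂ A).comap (LinearMap.mulLeft ℂ a) :=
          iSup₂_le fun I hI z hz =>
            (le_iSup₂ (f := fun (I : ClosedIdeal A) (_ : I ∈ S) => I.toSubmodule) I hI)
              (I.mul_mem_left a hz)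
        exact this hy
      mul_mem_right' := fun a {x} hx => by
        refine mul_mem_closure_right _ a (fun y hy => ?_) hx
        have : (⨆ I ∈ S, I.toSubmodule : Submodule ℂ A) ≤
            (⨆ I ∈ S, I.toSubmodule : Submodule ℂ A).comap (LinearMap.mulRight ℂ a) :=
          iSup₂_le fun I hI z hz =>
            (le_iSup₂ (f := fun (I : ClosedIdeal A) (_ : I ∈ S) => I.toSubmodule) I hI)
              (I.mul_mem_right a hz)
        exact this hy
      isClosed' := Submodule.isClosed_topologicalClosure _ }

theorem isGLB_sInf (S : Set (ClosedIdeal A)) : IsGLB S (sInf S) :=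
  ⟨fun I hI _ hx => mem_sInf.1 hx I hI, fun _ hJ _ hx => mem_sInf.2 fun _ hI => hJ hI hx⟩

theorem isLUB_sSup (S : Set (ClosedIdeal A)) : IsLUB S (sSup S) := by
  refine ⟨fun I hI x hx => ?_, fun J hJ => ?_⟩
  · exact Submodule.le_topologicalClosure _
      ((le_iSup₂ (f := fun (I : ClosedIdeal A) (_ : I ∈ S) => I.toSubmodule) I hI) hx)
  · have h : (⨆ I ∈ S, I.toSubmodule : Submodule ℂ A) ≤ J.toSubmodule :=
      iSup₂_le fun I hI => hJ hI
    exact Submodule.topologicalClosure_minimal _ h J.isClosed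

/-- The complete lattice of closed two-sided ideals. -/
instance : CompleteLattice (ClosedIdeal A) :=
  { completeLatticeOfInf (ClosedIdeal A) isGLB_sInf with
    sSup := sSup
    isLUB_sSup := isLUB_sSup }

theorem mem_inf {I J : ClosedIdeal A} {x : A} : x ∈ I ⊓ J ↔ x ∈ I ∧ x ∈ J := by
  rw [← sInf_pair, mem_sInf]
  simp

theorem mem_top (x : A) : x ∈ (⊤ : ClosedIdeal A) := by
  rw [← sInf_empty, mem_sInf]
  simp

variable (A) in
/-- The ideal `Ideal(x)`: the smallest closed two-sided ideal containing `x`. -/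
def gen (x : A) : ClosedIdeal A := sInf {I | x ∈ I}

/-- `x` is full in the C*-algebra `I`: it lies in `I`, and the only closed two-sided ideal
of the C*-algebra `I` that contains `x` is `I` itself. -/
def IsFullIn (x : A) (I : ClosedIdeal A) : Prop :=
  x ∈ I ∧ ∀ K : Submodule ℂ A, K ≤ I.toSubmodule → IsClosed (K : Set A) →
    (∀ a ∈ I, ∀ k ∈ K, a * k ∈ K ∧ k * a ∈ K) → x ∈ K → K = I.toSubmodule

/-- Preimage of a closed two-sided ideal under a *-homomorphism. -/
def comap {B : Type v} [NonUnitalCStarAlgebra B] (φ : A →⋆ₙₐ[ℂ] B) (J : ClosedIdeal B) :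
    ClosedIdeal A where
  carrier := φ ⁻¹' J
  zero_mem' := by
    change φ 0 ∈ J
    rw [map_zero]
    exact J.toSubmodule.zero_mem
  add_mem' {x y} hx hy := by
    change φ (x + y) ∈ J
    rw [map_add]
    exact J.toSubmodule.add_mem hx hy
  smul_mem' c {x} hx := by
    change φ (c • x) ∈ J
    rw [map_smul]
    exact J.toSubmodule.smul_mem c hx
  mul_mem_left' a {x} hx := by
    change φ (a * x) ∈ J
    rw [map_mul]
    exact J.mul_mem_left _ hx
  mul_mem_right' a {x} hx := by
    change φ (x * a) ∈ J
    rw [map_mul]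
    exact J.mul_mem_right _ hx
  isClosed' := J.isClosed.preimage
    (AddMonoidHomClass.continuous_of_bound φ 1
      (by simpa only [one_mul] using NonUnitalStarAlgHom.norm_apply_le φ))

end ClosedIdeal

/-- A *-representation on a Hilbert space is (topologically) irreducible: it is nonzero, and
the only closed invariant subspaces are the trivial ones. -/
def IsIrreducibleRep {A : Type u} [NonUnitalCStarAlgebra A] {H : Type v} [NormedAddCommGroup H]
    [InnerProductSpace ℂ H] [CompleteSpace H] (π : A →⋆ₙₐ[ℂ] (H →L[ℂ] H)) : Prop :=
  (∃ a, π a ≠ 0) ∧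
    ∀ K : Submodule ℂ H, IsClosed (K : Set H) → (∀ a, ∀ ξ ∈ K, π a ξ ∈ K) → K = ⊥ ∨ K = ⊤

/-- A primitive ideal is the kernel of an irreducible *-representation. (An irreducible
representation is cyclic, so Hilbert spaces in the universe of the algebra suffice.) -/
def ClosedIdeal.IsPrimitive {A : Type u} [NonUnitalCStarAlgebra A] (P : ClosedIdeal A) : Prop :=
  ∃ (H : Type u) (_ : NormedAddCommGroup H) (_ : InnerProductSpace ℂ H) (_ : CompleteSpace H)
    (π : A →⋆ₙₐ[ℂ] (H →L[ℂ] H)), IsIrreducibleRep π ∧ ∀ x, x ∈ P ↔ π x = 0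

theorem ClosedIdeal.IsPrimitive.exists_notMem {A : Type u} [NonUnitalCStarAlgebra A]
    {P : ClosedIdeal A} (hP : P.IsPrimitive) : ∃ a, a ∉ P := by
  obtain ⟨H, _, _, _, π, ⟨⟨a, ha⟩, -⟩, hker⟩ := hP
  exact ⟨a, fun h => ha ((hker a).1 h)⟩

theorem ClosedIdeal.IsPrimitive.prime {A : Type u} [NonUnitalCStarAlgebra A]
    {P : ClosedIdeal A} (hP : P.IsPrimitive) {I J : ClosedIdeal A} (h : I ⊓ J ≤ P) :
    I ≤ P ∨ J ≤ P := by
  obtain ⟨H, _, _, _, π, ⟨-, hirr⟩, hker⟩ := hP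
  by_contra! hcon
  obtain ⟨hI, hJ⟩ := hcon
  simp only [ClosedIdeal.le_iff, not_forall] at hI hJ
  obtain ⟨x, hx, hxP⟩ := hI
  obtain ⟨y, hy, hyP⟩ := hJ
  -- the closed subspace of the vectors annihilated by `J` is invariant
  let K : Submodule ℂ H := ⨅ z : J, LinearMap.ker (π z : H →ₗ[ℂ] H)
  have hK : ∀ ξ, ξ ∈ K ↔ ∀ z ∈ J, π z ξ = 0 := by
    intro ξ
    simp [K, Submodule.mem_iInf]
  have hKc : IsClosed (K : Set H) := by
    have : (K : Set H) = ⋂ z : J, {ξ | π z ξ = 0} := by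
      ext ξ
      simp [hK]
    rw [this]
    exact isClosed_iInter fun z => isClosed_eq (π z).continuous continuous_const
  have hKi : ∀ a, ∀ ξ ∈ K, π a ξ ∈ K := by
    intro a ξ hξ
    rw [hK] at hξ ⊢
    intro z hz
    have := hξ (z * a) (J.mul_mem_right a hz)
    rwa [map_mul] at this
  rcases hirr K hKc hKi with hbot | htop
  · apply hxP
    rw [hker]
    ext ξ
    have : π x ξ ∈ K := by
      rw [hK]
      intro z hz
      have hzx : z * x ∈ P :=
        ClosedIdeal.le_iff.1 h _
          (ClosedIdeal.mem_inf.2 ⟨I.mul_mem_left z hx, J.mul_mem_right x hz⟩)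
      have h0 := (hker _).1 hzx
      rw [map_mul] at h0
      exact congrArg (fun T : H →L[ℂ] H => T ξ) h0
    rw [hbot] at this
    simpa using this
  · apply hyP
    rw [hker]
    ext ξ
    exact (hK ξ).1 (htop ▸ Submodule.mem_top) y hy

/-- The primitive ideal space `Prim(A)`. -/
def Prim (A : Type u) [NonUnitalCStarAlgebra A] : Type u := {P : ClosedIdeal A // P.IsPrimitive}

namespace Prim

variable {A : Type u} [NonUnitalCStarAlgebra A]

/-- The hull of a closed ideal: the primitive ideals containing it. -/
def hull (I : ClosedIdeal A) : Set (Prim A) := {P | I ≤ P.1}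

theorem mem_hull {I : ClosedIdeal A} {P : Prim A} : P ∈ hull I ↔ I ≤ P.1 := Iff.rfl

/-- The Jacobson (hull-kernel) topology: the closed sets are exactly the hulls. -/
instance : TopologicalSpace (Prim A) :=
  TopologicalSpace.ofClosed (Set.range (hull (A := A)))
    ⟨⊤, Set.eq_empty_iff_forall_notMem.2 fun P hP => by
      obtain ⟨a, ha⟩ := P.2.exists_notMem
      exact ha (mem_hull.1 hP (ClosedIdeal.mem_top a))⟩
    (fun S hS => by
      refine ⟨sSup {I | hull I ∈ S}, ?_⟩
      ext P
      constructor
      · intro hP T hT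
        obtain ⟨I, rfl⟩ := hS hT
        exact mem_hull.2 ((le_sSup (a := I) hT).trans (mem_hull.1 hP))
      · intro hP
        exact mem_hull.2 (sSup_le fun I hI => hP _ hI))
    (by
      rintro _ ⟨I, rfl⟩ _ ⟨J, rfl⟩
      refine ⟨I ⊓ J, ?_⟩
      ext P
      constructor
      · intro hP
        exact P.2.prime hP
      · rintro (hP | hP)
        · exact mem_hull.2 (inf_le_left.trans (mem_hull.1 hP))
        · exact mem_hull.2 (inf_le_right.trans (mem_hull.1 hP)))

end Prim

/-- An action of a topological space `X` on a C*-algebra: an order preserving map from the open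
subsets of `X` to the closed two-sided ideals. -/
abbrev Action (X : Type v) [TopologicalSpace X] (A : Type u) [NonUnitalCStarAlgebra A] :=
  Opens X →o ClosedIdeal A

/-- The action `G ↦ ⋂_{J ∈ Prim(E) \ G} J` of `Prim(E)` on `E` (the empty intersection
being `E`). -/
def primAction (E : Type v) [NonUnitalCStarAlgebra E] : Action (Prim E) E where
  toFun G := sInf {J | ∃ P : Prim E, P ∉ G ∧ J = P.1}
  monotone' _ _ h := sInf_le_sInf fun _ ⟨P, hP, hJ⟩ => ⟨P, fun hPG => hP (h hPG), hJ⟩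

/-- The action `G ↦ φ⁻¹(⋂_{J ∈ Prim(E) \ G} J)` of `Prim(E)` on `D`. -/
def pullbackAction {D : Type u} {E : Type v} [NonUnitalCStarAlgebra D] [NonUnitalCStarAlgebra E]
    (φ : D →⋆ₙₐ[ℂ] E) : Action (Prim E) D where
  toFun G := (primAction E G).comap φ
  monotone' _ _ h _ hx := (primAction E).monotone h hx

section Equivariance

universe w

variable {X : Type w} [TopologicalSpace X] {D : Type u} {E : Type v}
  [NonUnitalCStarAlgebra D] [NonUnitalCStarAlgebra E]

/-- A *-homomorphism between `X`-C*-algebras is `X`-equivariant if it maps `D(U)` into `E(U)`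
for every open `U`. -/
def IsEquivariant (ΦD : Action X D) (ΦE : Action X E) (φ : D →⋆ₙₐ[ℂ] E) : Prop :=
  ∀ U : Opens X, φ '' (ΦD U) ⊆ ΦE U

/-- `U` is the smallest open set with `d ∈ D(U)`. -/
def IsSmallestSupport (ΦD : Action X D) (d : D) (U : Opens X) : Prop :=
  IsLeast {V : Opens X | d ∈ ΦD V} U

/-- A *-homomorphism between `X`-C*-algebras is `X`-full if each `d` has a smallest open `U` with
`d ∈ D(U)`, and `φ d` is full in `E(U)` for that `U`. -/
def IsXFull (ΦD : Action X D) (ΦE : Action X E) (φ : D →⋆ₙₐ[ℂ] E) : Prop :=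
  ∀ d : D, ∃ U : Opens X, IsSmallestSupport ΦD d U ∧ ClosedIdeal.IsFullIn (φ d) (ΦE U)

end Equivariance

end CStarX

/-!
Let `Ψ I` be the complement of the hull of a closed ideal `I`. By definition of the hull-kernel
topology every open subset of `Prim E` is of the form `Ψ I`, so `Φ_E` is an order isomorphism with
inverse `Ψ` as soon as `I` is the intersection of the primitive ideals containing it. Given
`x ∉ I`, compressing by `1 - e` along an approximate unit `e` of `I` shows that `-x*x` is not in
the closed cone `E₊ + I` (in the unitization), so Hahn-Banach gives a state that vanishes on `I` but
not at `x*x`. By Krein-Milman it can be taken to be an extreme point of the states vanishing on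
`I`; such a state is pure, and the kernel of its GNS representation is the required primitive
ideal.

Consequently `d ∈ D(U)` if and only if `Ψ(Ideal(φ(d))) ≤ U`, which gives the infima and identifies
`U_d` as `Ψ(Ideal(φ(d)))`. An approximate unit also shows that ideals of ideals are ideals, so
`ψ(d)` is full in `E(U_d) = Ideal(φ(d))` if and only if it generates that ideal.

For directed suprema, `φ⁻¹` has to commute with closures of directed unions of ideals. If `a` is
self-adjoint and `φ(a)` is at distance at most `r` from an ideal `J`, then pushing the spectrum of
`a` towards `0` by `r` changes `a` by at most `r` and moves it into `φ⁻¹(J)`.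
-/

namespace CStarX

universe u v

open Filter Topology ComplexOrder ComplexStarModule Pointwise InnerProductSpace CStarAlgebra

namespace ClosedIdeal

variable {A : Type u} [NonUnitalCStarAlgebra A]

theorem add_mem (J : ClosedIdeal A) {x y : A} (hx : x ∈ J) (hy : y ∈ J) : x + y ∈ J :=
  J.toSubmodule.add_mem hx hy

theorem sub_mem (J : ClosedIdeal A) {x y : A} (hx : x ∈ J) (hy : y ∈ J) : x - y ∈ J :=
  J.toSubmodule.sub_mem hx hy

theorem smul_mem (J : ClosedIdeal A) (c : ℂ) {x : A} (hx : x ∈ J) : c • x ∈ J :=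
  J.toSubmodule.smul_mem c hx

/-- The C*-subalgebra `J ∩ J*` attached to a closed ideal `J`; it is a stepping stone towards
`J = J*` (`star_mem`), after which it is all of `J`. -/
def starCore (J : ClosedIdeal A) : NonUnitalStarSubalgebra ℂ A where
  carrier := {x | x ∈ J ∧ star x ∈ J}
  zero_mem' := ⟨J.toSubmodule.zero_mem, by rw [star_zero]; exact J.toSubmodule.zero_mem⟩
  add_mem' hx hy := ⟨J.add_mem hx.1 hy.1, by rw [star_add]; exact J.add_mem hx.2 hy.2⟩
  smul_mem' c _ hx := ⟨J.smul_mem c hx.1, by rw [star_smul]; exact J.smul_mem _ hx.2⟩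
  mul_mem' hx hy := ⟨J.mul_mem_left _ hy.1, by rw [star_mul]; exact J.mul_mem_left _ hx.2⟩
  star_mem' hx := ⟨hx.2, by rw [star_star]; exact hx.1⟩

instance (J : ClosedIdeal A) : IsClosed (J.starCore : Set A) :=
  J.isClosed.inter (J.isClosed.preimage continuous_star)

theorem norm_sub_mul_sq_le {e : A} (he : IsSelfAdjoint e) (he1 : ‖e‖ ≤ 1) (y : A) :
    ‖y - y * e‖ ^ 2 ≤ 2 * ‖star y * y - star y * y * e‖ := by
  set b := star y * y
  have key : star (y - y * e) * (y - y * e) = (b - b * e) - e * (b - b * e) := by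
    simp only [b, star_sub, star_mul, he.star_eq, sub_mul, mul_sub, mul_assoc]
    exact sub_sub_sub_comm _ _ _ _
  calc ‖y - y * e‖ ^ 2 = ‖(b - b * e) - e * (b - b * e)‖ := by
        rw [← key, CStarRing.norm_star_mul_self, sq]
    _ ≤ ‖b - b * e‖ + ‖e‖ * ‖b - b * e‖ :=
        (norm_sub_le _ _).trans (by gcongr; exact norm_mul_le _ _)
    _ ≤ ‖b - b * e‖ + 1 * ‖b - b * e‖ := by gcongr
    _ = 2 * ‖b - b * e‖ := by ring

theorem exists_approximateUnit (J : ClosedIdeal A) :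
    ∃ l : Filter A, l.NeBot ∧ (∀ᶠ e in l, e ∈ J ∧ IsSelfAdjoint e ∧ ‖e‖ ≤ 1) ∧
      ∀ y, star y * y ∈ J → Tendsto (y * ·) l (𝓝 y) := by
  let := CStarAlgebra.spectralOrder J.starCore
  have := CStarAlgebra.spectralOrderedRing J.starCore
  have hl := CStarAlgebra.increasingApproximateUnit J.starCore
  have hunit : ∀ᶠ e in (CStarAlgebra.approximateUnit J.starCore).map Subtype.val,
      e ∈ J ∧ IsSelfAdjoint e ∧ ‖e‖ ≤ 1 := by
    refine eventually_map.2 ?_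
    filter_upwards [hl.eventually_star_eq, hl.eventually_norm] with e he he1
    exact ⟨e.2.1, congrArg Subtype.val he, he1⟩
  refine ⟨_, inferInstance, hunit, fun y hy => ?_⟩
  have hb : Tendsto (fun e => 2 * ‖star y * y - star y * y * e‖)
      ((CStarAlgebra.approximateUnit J.starCore).map Subtype.val) (𝓝 0) := by
    have hmem : star y * y ∈ J.starCore := ⟨hy, by rwa [star_mul, star_star]⟩
    have h := (continuous_subtype_val.tendsto _).comp (hl.tendsto_mul_left ⟨_, hmem⟩)
    refine tendsto_map'_iff.2 ?_
    simpa [Function.comp_def] using (h.const_sub (star y * y)).norm.const_mul 2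
  refine tendsto_iff_norm_sub_tendsto_zero.2 ?_
  have hsq := squeeze_zero' (.of_forall fun e => sq_nonneg ‖y - y * e‖)
    (hunit.mono fun e he => norm_sub_mul_sq_le he.2.1 he.2.2 y) hb
  simpa [norm_sub_rev, Real.sqrt_sq] using hsq.sqrt

theorem mem_of_star_mul_self_mem (J : ClosedIdeal A) {y : A} (hy : star y * y ∈ J) : y ∈ J := by
  obtain ⟨l, _, hl, hlim⟩ := J.exists_approximateUnit
  exact J.isClosed.mem_of_tendsto (hlim y hy) (hl.mono fun e he => J.mul_mem_left y he.1)

theorem star_mem (J : ClosedIdeal A) {y : A} (hy : y ∈ J) : star y ∈ J :=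
  J.mem_of_star_mul_self_mem (by rw [star_star]; exact J.mul_mem_right _ hy)

/-- A closed two-sided ideal of the C*-algebra `J` is a closed two-sided ideal of `A`. -/
def ofIdealOfIdeal (J : ClosedIdeal A) (K : Submodule ℂ A) (hKJ : K ≤ J.toSubmodule)
    (hK : IsClosed (K : Set A)) (hmul : ∀ a ∈ J, ∀ k ∈ K, a * k ∈ K ∧ k * a ∈ K) :
    ClosedIdeal A where
  toSubmodule := K
  mul_mem_left' a k hk := by
    obtain ⟨l, _, hl, hlim⟩ := J.exists_approximateUnit
    have hek : Tendsto (fun e => star (star k * e)) l (𝓝 k) := by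
      simpa using (hlim (star k) (J.mul_mem_left _ (J.star_mem (hKJ hk)))).star
    have hak : Tendsto (fun e => a * star (star k * e)) l (𝓝 (a * k)) := hek.const_mul a
    refine hK.mem_of_tendsto hak (hl.mono fun e he => ?_)
    rw [star_mul, star_star, he.2.1.star_eq, ← mul_assoc]
    exact (hmul _ (J.mul_mem_left a he.1) k hk).1
  mul_mem_right' a k hk := by
    obtain ⟨l, _, hl, hlim⟩ := J.exists_approximateUnit
    have hka : Tendsto (fun e => k * (e * a)) l (𝓝 (k * a)) := by
      simpa only [mul_assoc] using (hlim k (J.mul_mem_left _ (hKJ hk))).mul_const a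
    exact hK.mem_of_tendsto hka (hl.mono fun e he => (hmul _ (J.mul_mem_right a he.1) k hk).2)
  isClosed' := hK

theorem mem_gen (x : A) : x ∈ gen A x :=
  mem_sInf.2 fun _ hI => hI

theorem gen_le_iff {x : A} {I : ClosedIdeal A} : gen A x ≤ I ↔ x ∈ I :=
  ⟨fun h => h (mem_gen x), fun h => sInf_le h⟩

theorem isFullIn_iff_gen_eq {x : A} {I : ClosedIdeal A} : IsFullIn x I ↔ gen A x = I := by
  constructor
  · rintro ⟨hx, hfull⟩
    have hle : gen A x ≤ I := gen_le_iff.2 hx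
    have heq := hfull (gen A x).toSubmodule hle (gen A x).isClosed
      (fun a _ k hk => ⟨(gen A x).mul_mem_left a hk, (gen A x).mul_mem_right a hk⟩) (mem_gen x)
    exact le_antisymm hle heq.ge
  · rintro rfl
    refine ⟨mem_gen x, fun K hK hclosed hmul hxK => le_antisymm hK ?_⟩
    exact gen_le_iff (I := ofIdealOfIdeal _ K hK hclosed hmul) |>.2 hxK

end ClosedIdeal

section PositiveFunctionals

theorem norm_apply_star_mul_sq_le {A : Type u} [NonUnitalCStarAlgebra A] [PartialOrder A]
    [StarOrderedRing A] (f : A →ₚ[ℂ] ℂ) (a b : A) :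
    ‖f (star a * b)‖ ^ 2 ≤ ‖f (star a * a)‖ * ‖f (star b * b)‖ := by
  have hnorm (c : A) : ‖f (star c * c)‖ = ‖f.toPreGNS c‖ ^ 2 := by
    have h := f.preGNS_norm_sq (f.toPreGNS c)
    rw [f.ofPreGNS_toPreGNS] at h
    rw [← h, norm_pow, Complex.norm_real, norm_norm]
  rw [hnorm, hnorm, ← mul_pow]
  gcongr
  exact norm_inner_le_norm (𝕜 := ℂ) (f.toPreGNS a) (f.toPreGNS b)

variable {B : Type u} [CStarAlgebra B] [PartialOrder B] [StarOrderedRing B]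

theorem norm_apply_sq_le (f : B →ₚ[ℂ] ℂ) (b : B) :
    ‖f b‖ ^ 2 ≤ ‖f 1‖ * ‖f (star b * b)‖ := by
  simpa using norm_apply_star_mul_sq_le f 1 b

theorem norm_apply_le (f : B →ₚ[ℂ] ℂ) (b : B) : ‖f b‖ ≤ ‖f 1‖ * ‖b‖ := by
  refine le_of_sq_le_sq ?_ (by positivity)
  calc ‖f b‖ ^ 2 ≤ ‖f 1‖ * ‖f (star b * b)‖ := norm_apply_sq_le f b
    _ ≤ ‖f 1‖ * (‖f 1‖ * ‖star b * b‖) := by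
        gcongr
        exact f.norm_apply_le_of_nonneg _ (star_mul_self_nonneg b)
    _ = (‖f 1‖ * ‖b‖) ^ 2 := by rw [CStarRing.norm_star_mul_self]; ring

/-- The complex-linear extension `b ↦ F (ℜ b) + i F (ℑ b)` of a real functional `F` that is
nonnegative on the positive cone. -/
noncomputable def complexify (F : B →ₗ[ℝ] ℝ) (hF : ∀ b, 0 ≤ b → 0 ≤ F b) : B →ₚ[ℂ] ℂ :=
  .mk₀ (Module.Dual.extendRCLike (𝕜 := ℂ)
      { toFun := fun b => F (ℜ b)
        map_add' := fun a b => by rw [map_add, AddSubgroup.coe_add, map_add]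
        map_smul' := fun r b => by
          rw [map_smul, selfAdjoint.val_smul, map_smul, RingHom.id_apply] })
    fun b hb => by
      have hsa := IsSelfAdjoint.of_nonneg hb
      simpa [Module.Dual.extendRCLike_apply, hsa.coe_realPart, hsa.imaginaryPart] using hF b hb

theorem complexify_apply {F : B →ₗ[ℝ] ℝ} (hF : ∀ b, 0 ≤ b → 0 ≤ F b) (b : B) :
    complexify F hF b = F (ℜ b) + Complex.I * F (ℑ b) := by
  change Module.Dual.extendRCLike _ b = _
  simp [Module.Dual.extendRCLike_apply]

theorem infDist_sq_le_of_star_mul_self_le_add (J : ClosedIdeal B) {x b r : B} (hr : r ∈ J)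
    (hle : star x * x ≤ b + r) : Metric.infDist x J ^ 2 ≤ 4 * ‖b‖ := by
  obtain ⟨l, _, hl, hlim⟩ := J.exists_approximateUnit
  have hbound : ∀ᶠ e in l, Metric.infDist x J ^ 2 ≤ 4 * ‖b‖ + 2 * ‖r - r * e‖ := by
    filter_upwards [hl] with e ⟨heJ, he, he1⟩
    have hu : star (1 - e) = 1 - e := by rw [star_sub, star_one, he.star_eq]
    have hu2 : ‖1 - e‖ ≤ 2 := by
      nontriviality B
      linarith [norm_sub_le (1 : B) e, CStarRing.norm_one (E := B)]
    have hdist : Metric.infDist x J ≤ ‖x - x * e‖ := by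
      rw [← dist_eq_norm]
      exact Metric.infDist_le_dist_of_mem (J.mul_mem_left x heJ)
    have hconj : star (x - x * e) * (x - x * e) = (1 - e) * (star x * x) * (1 - e) := by
      rw [star_sub, star_mul, he.star_eq]
      noncomm_ring
    calc Metric.infDist x J ^ 2 ≤ ‖x - x * e‖ ^ 2 := by gcongr; exact Metric.infDist_nonneg
      _ = ‖(1 - e) * (star x * x) * (1 - e)‖ := by rw [sq, ← CStarRing.norm_star_mul_self, hconj]
      _ ≤ ‖(1 - e) * (b + r) * (1 - e)‖ := by
        refine CStarAlgebra.norm_le_norm_of_nonneg_of_le ?_ ?_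
        · exact hconj ▸ star_mul_self_nonneg _
        · simpa only [hu] using star_left_conjugate_le_conjugate hle (1 - e)
      _ = ‖(1 - e) * b * (1 - e) + (1 - e) * (r - r * e)‖ := by noncomm_ring
      _ ≤ ‖1 - e‖ * ‖b‖ * ‖1 - e‖ + ‖1 - e‖ * ‖r - r * e‖ := by
        refine (norm_add_le _ _).trans (add_le_add ((norm_mul_le _ _).trans ?_) (norm_mul_le _ _))
        gcongr
        exact norm_mul_le _ _
      _ ≤ 2 * ‖b‖ * 2 + 2 * ‖r - r * e‖ := by gcongr
      _ = 4 * ‖b‖ + 2 * ‖r - r * e‖ := by ring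
  have hlimr : Tendsto (fun e => 4 * ‖b‖ + 2 * ‖r - r * e‖) l (𝓝 (4 * ‖b‖)) := by
    have hr := ((hlim r (J.mul_mem_left _ hr)).const_sub r).norm.const_mul 2
    simpa using hr.const_add (4 * ‖b‖)
  exact ge_of_tendsto hlimr hbound

theorem mem_of_neg_star_mul_self_mem_closure (J : ClosedIdeal B) {x : B}
    (hx : -(star x * x) ∈ closure (Set.Ici 0 + (J : Set B))) : x ∈ J := by
  have hdist : Metric.infDist x J ^ 2 ≤ 0 := by
    refine le_of_forall_pos_le_add fun ε hε => ?_
    obtain ⟨_, ⟨p, hp, y, hy, rfl⟩, hz⟩ := Metric.mem_closure_iff.1 hx (ε / 4) (by positivity)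
    set w := p + y + star x * x
    have hw : ‖w‖ < ε / 4 := by
      rw [dist_comm, dist_eq_norm, sub_neg_eq_add] at hz
      exact hz
    have hle : star x * x ≤ w + -y := by
      have : w + -y = p + star x * x := by simp only [w]; abel
      rw [this]
      exact le_add_of_nonneg_left hp
    linarith [infDist_sq_le_of_star_mul_self_le_add J (J.toSubmodule.neg_mem hy) hle]
  rw [← SetLike.mem_coe, J.isClosed.mem_iff_infDist_zero ⟨0, J.toSubmodule.zero_mem⟩]
  exact pow_eq_zero_iff two_ne_zero |>.1 (le_antisymm hdist (sq_nonneg _))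

theorem exists_positive_apply_ne_zero (J : ClosedIdeal B) {x : B} (hx : x ∉ J) :
    ∃ g : B →ₚ[ℂ] ℂ, (∀ y ∈ J, g y = 0) ∧ g (star x * x) ≠ 0 := by
  let C : PointedCone ℝ B := .positive ℝ B ⊔ .ofSubmodule (J.toSubmodule.restrictScalars ℝ)
  have hxC : -(star x * x) ∉ C.closure := fun h =>
    hx (mem_of_neg_star_mul_self_mem_closure J (closure_mono (Submodule.coe_sup _ _).le h))
  obtain ⟨F, hFC, hFx⟩ := ProperCone.hyperplane_separation_point
    (⟨C.closure, isClosed_closure⟩ : ProperCone ℝ B) hxC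
  have hFpos (b : B) (hb : 0 ≤ b) : 0 ≤ F.toLinearMap b :=
    hFC b (subset_closure (Submodule.mem_sup_left hb))
  have hFJ (y : B) (hy : y ∈ J) : F y = 0 := by
    have hJ (y : B) (hy : y ∈ J) : 0 ≤ F y := hFC y (subset_closure (Submodule.mem_sup_right hy))
    exact le_antisymm (by simpa using hJ _ (J.toSubmodule.neg_mem hy)) (hJ y hy)
  have hFx' : 0 < F (star x * x) := by simpa using hFx
  refine ⟨complexify F.toLinearMap hFpos, fun y hy => ?_, ?_⟩
  · have hre : F (ℜ y) = 0 := by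
      rw [realPart_apply_coe, map_smul, map_add, hFJ y hy, hFJ _ (J.star_mem hy), add_zero,
        smul_zero]
    have him : F (ℑ y) = 0 := hFJ _ <| by
      rw [imaginaryPart_apply_coe]
      exact J.smul_mem _ (J.smul_mem _ (J.sub_mem hy (J.star_mem hy)))
    rw [complexify_apply]
    simp [hre, him]
  · rw [complexify_apply]
    simp [(IsSelfAdjoint.star_mul_self x).coe_realPart,
      (IsSelfAdjoint.star_mul_self x).imaginaryPart, hFx'.ne']

end PositiveFunctionals

section PureStates

variable {B : Type u} [CStarAlgebra B] [PartialOrder B]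

/-- The states of `B` that vanish on a closed ideal `J`, i.e. the state space of `B ⧸ J`, with the
weak-* topology. -/
def statesVanishingOn (J : ClosedIdeal B) : Set (WeakDual ℂ B) :=
  {g | (∀ b, 0 ≤ b → 0 ≤ g b) ∧ g 1 = 1 ∧ ∀ y ∈ J, g y = 0}

theorem convex_statesVanishingOn (J : ClosedIdeal B) : Convex ℝ (statesVanishingOn J) := by
  rintro g hg h hh s t hs ht hst
  refine ⟨fun b hb => ?_, ?_, fun y hy => ?_⟩
  · exact add_nonneg (smul_nonneg hs (hg.1 b hb)) (smul_nonneg ht (hh.1 b hb))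
  · change s • g 1 + t • h 1 = 1
    rw [hg.2.1, hh.2.1, ← add_smul, hst, one_smul]
  · change s • g y + t • h y = 0
    rw [hg.2.2 y hy, hh.2.2 y hy, smul_zero, smul_zero, add_zero]

theorem add_mem_statesVanishingOn {J : ClosedIdeal B} {f d : WeakDual ℂ B}
    (hf : f ∈ statesVanishingOn J) (hpos : ∀ b, 0 ≤ b → 0 ≤ f b + d b) (hd1 : d 1 = 0)
    (hdJ : ∀ y ∈ J, d y = 0) : f + d ∈ statesVanishingOn J := by
  refine ⟨hpos, ?_, fun y hy => ?_⟩
  · change f 1 + d 1 = 1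
    rw [hf.2.1, hd1, add_zero]
  · change f y + d y = 0
    rw [hf.2.2 y hy, hdJ y hy, add_zero]

variable [StarOrderedRing B]

theorem isCompact_statesVanishingOn (J : ClosedIdeal B) : IsCompact (statesVanishingOn J) := by
  have hball := WeakDual.isCompact_closedBall (0 : StrongDual ℂ B) 1
  refine hball.of_isClosed_subset ?_ fun g hg => ?_
  · simp only [statesVanishingOn, Set.ofPred_and, Set.ofPred_forall]
    refine .inter ?_ (.inter ?_ ?_)
    · exact isClosed_iInter fun b => isClosed_iInter fun _ =>
        isClosed_Ici.preimage (WeakDual.eval_continuous b)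
    · exact isClosed_singleton.preimage (WeakDual.eval_continuous 1)
    · exact isClosed_iInter fun y => isClosed_iInter fun _ =>
        isClosed_singleton.preimage (WeakDual.eval_continuous y)
  · refine mem_closedBall_zero_iff.2 (ContinuousLinearMap.opNorm_le_bound _ zero_le_one fun b => ?_)
    have hle : ‖g b‖ ≤ ‖g 1‖ * ‖b‖ := norm_apply_le (.mk₀ g.toStrongDual.toLinearMap hg.1) b
    rwa [hg.2.1, norm_one] at hle

theorem exists_mem_statesVanishingOn_apply_ne_zero (J : ClosedIdeal B) {x : B} (hx : x ∉ J) :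
    ∃ g ∈ statesVanishingOn J, g (star x * x) ≠ 0 := by
  obtain ⟨f, hfJ, hfx⟩ := exists_positive_apply_ne_zero J hx
  have hf1 : 0 ≤ f 1 := f.map_nonneg zero_le_one
  have hf1' : f 1 ≠ 0 := fun h => hfx <| by
    simpa [h] using norm_apply_le f (star x * x)
  refine ⟨StrongDual.toWeakDual ((f 1)⁻¹ • ⟨f.toLinearMap, map_continuous f⟩),
    ⟨fun b hb => mul_nonneg (inv_nonneg.2 hf1) (f.map_nonneg hb), inv_mul_cancel₀ hf1',
      fun y hy => ?_⟩, mul_ne_zero (inv_ne_zero hf1') hfx⟩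
  change (f 1)⁻¹ * f y = 0
  rw [hfJ y hy, mul_zero]

/-- A positive functional is pure if it dominates only its own multiples. -/
def IsPure (f : B →ₚ[ℂ] ℂ) : Prop :=
  ∀ g : B →ₚ[ℂ] ℂ, (∀ b, 0 ≤ b → g b ≤ f b) → ∃ t : ℂ, ∀ b, g b = t * f b

theorem apply_eq_zero_of_le {f g : B →ₚ[ℂ] ℂ} (hgf : ∀ b, 0 ≤ b → g b ≤ f b) {J : ClosedIdeal B}
    (hf : ∀ y ∈ J, f y = 0) : ∀ y ∈ J, g y = 0 := by
  intro y hy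
  have hle := hgf _ (star_mul_self_nonneg y)
  rw [hf _ (J.mul_mem_left _ hy)] at hle
  have hzero : g (star y * y) = 0 := le_antisymm hle (g.map_nonneg (star_mul_self_nonneg y))
  simpa [hzero] using norm_apply_sq_le g y

theorem isPure_of_mem_extremePoints {J : ClosedIdeal B} {f : WeakDual ℂ B}
    (hf : f ∈ (statesVanishingOn J).extremePoints ℝ) :
    IsPure (.mk₀ f.toStrongDual.toLinearMap hf.1.1) := by
  obtain ⟨⟨hpos, hf1, hfJ⟩, hext⟩ := mem_extremePoints.1 hf
  intro g hg
  have hgJ := apply_eq_zero_of_le hg hfJ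
  have hle (b : B) (hb : 0 ≤ b) : g b ≤ f b := hg b hb
  have hg1 : 0 ≤ g 1 := g.map_nonneg zero_le_one
  have hg1' : 0 ≤ 1 - g 1 := sub_nonneg.2 (hf1 ▸ hle 1 zero_le_one)
  -- `f` is the midpoint of the states `f ± (g - g(1) f)`
  let d : WeakDual ℂ B := StrongDual.toWeakDual ⟨g.toLinearMap, map_continuous g⟩ - g 1 • f
  have hd (b : B) : d b = g b - g 1 * f b := rfl
  have hd1 : d 1 = 0 := by rw [hd, hf1, mul_one, sub_self]
  have hdJ (y : B) (hy : y ∈ J) : d y = 0 := by rw [hd, hfJ y hy, hgJ y hy, mul_zero, sub_zero]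
  have hadd : f + d ∈ statesVanishingOn J := by
    refine add_mem_statesVanishingOn hf.1 (fun b hb => ?_) hd1 hdJ
    calc 0 ≤ (1 - g 1) * f b + g b := add_nonneg (mul_nonneg hg1' (hpos b hb)) (g.map_nonneg hb)
      _ = f b + d b := by rw [hd]; ring
  have hsub : f - d ∈ statesVanishingOn J := by
    rw [sub_eq_add_neg]
    refine add_mem_statesVanishingOn hf.1 (fun b hb => ?_) (neg_eq_zero.2 hd1)
      fun y hy => neg_eq_zero.2 (hdJ y hy)
    calc 0 ≤ g 1 * f b + (f b - g b) :=
          add_nonneg (mul_nonneg hg1 (hpos b hb)) (sub_nonneg.2 (hle b hb))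
      _ = f b + -(d b) := by rw [hd]; ring
  have hmid : f ∈ openSegment ℝ (f + d) (f - d) :=
    ⟨2⁻¹, 2⁻¹, by norm_num, by norm_num, by norm_num, DFunLike.ext _ _ fun b => by
      change (2⁻¹ : ℝ) • (f b + d b) + (2⁻¹ : ℝ) • (f b - d b) = f b
      module⟩
  have hd0 : d = 0 := by simpa using (hext _ hadd _ hsub hmid).1
  exact ⟨g 1, fun b => sub_eq_zero.1 (DFunLike.congr_fun hd0 b)⟩

theorem exists_isPure_apply_ne_zero (J : ClosedIdeal B) {x : B} (hx : x ∉ J) :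
    ∃ f : B →ₚ[ℂ] ℂ, IsPure f ∧ (∀ y ∈ J, f y = 0) ∧ f (star x * x) ≠ 0 := by
  by_contra! hcon
  obtain ⟨g, hg, hgx⟩ := exists_mem_statesVanishingOn_apply_ne_zero J hx
  let N : Submodule ℝ (WeakDual ℂ B) :=
    { carrier := {h | h (star x * x) = 0}
      zero_mem' := rfl
      add_mem' := fun {a b} ha hb => by
        change a (star x * x) + b (star x * x) = 0
        rw [ha, hb, add_zero]
      smul_mem' := fun c a ha => by
        change c • a (star x * x) = 0
        rw [ha, smul_zero] }
  have hN : IsClosed (N : Set (WeakDual ℂ B)) :=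
    isClosed_singleton.preimage (WeakDual.eval_continuous (star x * x))
  have hext : (statesVanishingOn J).extremePoints ℝ ⊆ N := fun f hf =>
    hcon _ (isPure_of_mem_extremePoints hf) hf.1.2.2
  let : LocallyConvexSpace ℝ (WeakDual ℂ B) :=
    (topDualPairing ℂ B).weakBilin_withSeminorms.toLocallyConvexSpace
  have hKM := closure_convexHull_extremePoints (E := WeakDual ℂ B) (isCompact_statesVanishingOn J)
    (convex_statesVanishingOn J)
  rw [← hKM] at hg
  exact hgx (closure_minimal (convexHull_min hext N.convex) hN hg)

end PureStates

section Representations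

variable {B : Type u} [CStarAlgebra B] {H : Type v} [NormedAddCommGroup H] [InnerProductSpace ℂ H]
  [CompleteSpace H]

theorem inner_map_left (π : B →⋆ₐ[ℂ] (H →L[ℂ] H)) (b : B) (η ζ : H) :
    ⟪π b η, ζ⟫_ℂ = ⟪η, π (star b) ζ⟫_ℂ := by
  rw [map_star, ContinuousLinearMap.star_eq_adjoint, ContinuousLinearMap.adjoint_inner_right]

theorem starProjection_map_apply (π : B →⋆ₐ[ℂ] (H →L[ℂ] H)) (K : Submodule ℂ H)
    [K.HasOrthogonalProjection] (hK : ∀ b, ∀ η ∈ K, π b η ∈ K) (b : B) (η : H) :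
    K.starProjection (π b η) = π b (K.starProjection η) := by
  refine Submodule.eq_starProjection_of_mem_orthogonal
    (hK b _ (K.starProjection_apply_mem η)) ?_
  rw [← map_sub, Submodule.mem_orthogonal']
  intro ζ hζ
  rw [inner_map_left]
  exact (Submodule.mem_orthogonal' _ _).1 (K.sub_starProjection_mem_orthogonal η) _ (hK _ _ hζ)

theorem inner_map_star_mul_self (π : B →⋆ₐ[ℂ] (H →L[ℂ] H)) (b : B) (η : H) :
    ⟪η, π (star b * b) η⟫_ℂ = (‖π b η‖ ^ 2 : ℝ) := by
  rw [map_mul, mul_apply_eq_comp, ← inner_map_left, inner_self_eq_norm_sq_to_K]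
  norm_cast

variable [PartialOrder B] [StarOrderedRing B]

/-- The positive functional `b ↦ ⟪η, π b η⟫` attached to a vector `η` of a representation `π`. -/
noncomputable def vectorFunctional (π : B →⋆ₐ[ℂ] (H →L[ℂ] H)) (η : H) : B →ₚ[ℂ] ℂ :=
  .mk₀ { toFun := fun b => ⟪η, π b η⟫_ℂ
         map_add' := fun a b => by
          rw [map_add, add_apply, inner_add_right]
         map_smul' := fun c b => by
          rw [map_smul, smul_apply, inner_smul_right]; rfl }
    fun b hb => by
      obtain ⟨c, rfl⟩ := CStarAlgebra.nonneg_iff_eq_star_mul_self.1 hb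
      exact (Complex.zero_le_real.2 (sq_nonneg _)).trans_eq (inner_map_star_mul_self π c η).symm

theorem vectorFunctional_apply (π : B →⋆ₐ[ℂ] (H →L[ℂ] H)) (η : H) (b : B) :
    vectorFunctional π η b = ⟪η, π b η⟫_ℂ := rfl

theorem vectorFunctional_starProjection_le (π : B →⋆ₐ[ℂ] (H →L[ℂ] H)) (K : Submodule ℂ H)
    [K.HasOrthogonalProjection] (hK : ∀ b, ∀ η ∈ K, π b η ∈ K) (η : H) (b : B) (hb : 0 ≤ b) :
    vectorFunctional π (K.starProjection η) b ≤ vectorFunctional π η b := by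
  obtain ⟨c, rfl⟩ := CStarAlgebra.nonneg_iff_eq_star_mul_self.1 hb
  rw [vectorFunctional_apply, vectorFunctional_apply, inner_map_star_mul_self,
    inner_map_star_mul_self, Complex.real_le_real, ← starProjection_map_apply π K hK]
  gcongr
  exact K.norm_starProjection_apply_le _

theorem exists_starProjection_eq_smul_of_isPure {π : B →⋆ₐ[ℂ] (H →L[ℂ] H)} {ξ : H}
    (hcyc : DenseRange fun b => π b ξ) (hpure : IsPure (vectorFunctional π ξ))
    (K : Submodule ℂ H) [K.HasOrthogonalProjection] (hK : ∀ b, ∀ η ∈ K, π b η ∈ K) :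
    ∃ c : ℂ, ∀ η, K.starProjection η = c • η := by
  obtain ⟨t, ht⟩ := hpure _ (vectorFunctional_starProjection_le π K hK ξ)
  have hmatrix (b : B) : ⟪K.starProjection ξ, π b ξ⟫_ℂ = ⟪star t • ξ, π b ξ⟫_ℂ := by
    have hproj := K.starProjection_eq_self_iff.2 (K.starProjection_apply_mem ξ)
    calc ⟪K.starProjection ξ, π b ξ⟫_ℂ = ⟪K.starProjection ξ, π b (K.starProjection ξ)⟫_ℂ := by
          rw [← starProjection_map_apply π K hK, ← K.inner_starProjection_left_eq_right, hproj]
      _ = t * ⟪ξ, π b ξ⟫_ℂ := ht b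
      _ = ⟪star t • ξ, π b ξ⟫_ℂ := by rw [inner_smul_left, Complex.star_def, Complex.conj_conj]
  have hξ : K.starProjection ξ = star t • ξ := ext_inner_right ℂ fun v => congrFun
    (hcyc.equalizer (g := fun v => ⟪K.starProjection ξ, v⟫_ℂ) (h := fun v => ⟪star t • ξ, v⟫_ℂ)
      (by fun_prop) (by fun_prop) (funext hmatrix)) v
  refine ⟨star t, fun η => congrFun (hcyc.equalizer (h := fun η => star t • η)
    K.starProjection.continuous (by fun_prop) (funext fun b => ?_)) η⟩
  rw [Function.comp_apply, starProjection_map_apply π K hK, hξ, map_smul]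
  rfl

theorem eq_bot_or_eq_top_of_isPure {π : B →⋆ₐ[ℂ] (H →L[ℂ] H)} {ξ : H}
    (hcyc : DenseRange fun b => π b ξ) (hpure : IsPure (vectorFunctional π ξ))
    {K : Submodule ℂ H} (hclosed : IsClosed (K : Set H)) (hK : ∀ b, ∀ η ∈ K, π b η ∈ K) :
    K = ⊥ ∨ K = ⊤ := by
  have : CompleteSpace K := hclosed.completeSpace_coe
  obtain ⟨c, hc⟩ := exists_starProjection_eq_smul_of_isPure hcyc hpure K hK
  rcases eq_or_ne c 0 with rfl | hc0
  · refine .inl ((Submodule.eq_bot_iff K).2 fun η hη => ?_)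
    rw [← Submodule.starProjection_eq_self_iff.2 hη, hc, zero_smul]
  · refine .inr ((Submodule.eq_top_iff').2 fun η => ?_)
    exact (K.smul_mem_iff hc0).1 (hc η ▸ K.starProjection_apply_mem η)

variable (f : B →ₚ[ℂ] ℂ)

theorem gnsStarAlgHom_apply_toPreGNS_one (b : B) :
    f.gnsStarAlgHom b (f.toPreGNS 1 : f.GNS) = (f.toPreGNS b : f.GNS) := by
  simp [PositiveLinearMap.gnsStarAlgHom_apply]

theorem denseRange_gnsStarAlgHom_toPreGNS_one :
    DenseRange fun b => f.gnsStarAlgHom b (f.toPreGNS 1 : f.GNS) := by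
  simp only [gnsStarAlgHom_apply_toPreGNS_one]
  exact UniformSpace.Completion.denseRange_coe.comp f.toPreGNS.surjective.denseRange
    (UniformSpace.Completion.continuous_coe _)

theorem vectorFunctional_gnsStarAlgHom :
    vectorFunctional f.gnsStarAlgHom (f.toPreGNS 1 : f.GNS) = f := by
  ext b
  rw [vectorFunctional_apply, gnsStarAlgHom_apply_toPreGNS_one,
    UniformSpace.Completion.inner_coe, f.preGNS_inner_def, f.ofPreGNS_toPreGNS,
    f.ofPreGNS_toPreGNS, star_one, one_mul]

end Representations

section Primitive

theorem map_eq_zero_of_vectorFunctional_eq_zero {B : Type u} [CStarAlgebra B] [PartialOrder B]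
    [StarOrderedRing B] {H : Type v} [NormedAddCommGroup H] [InnerProductSpace ℂ H]
    [CompleteSpace H] {π : B →⋆ₐ[ℂ] (H →L[ℂ] H)} {ξ : H} (hcyc : DenseRange fun b => π b ξ)
    {J : ClosedIdeal B} (hJ : ∀ y ∈ J, vectorFunctional π ξ y = 0) : ∀ y ∈ J, π y = 0 := by
  intro y hy
  refine DFunLike.coe_injective (hcyc.equalizer (π y).continuous continuous_const ?_)
  funext b
  have hyb := hJ _ (J.mul_mem_left (star (y * b)) (J.mul_mem_right b hy))
  rw [vectorFunctional_apply, inner_map_star_mul_self, map_mul, mul_apply_eq_comp] at hyb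
  simpa using hyb

namespace ClosedIdeal

variable {A : Type u} [NonUnitalCStarAlgebra A]

/-- A closed ideal of `A`, seen as a closed ideal of the unitization of `A`. -/
noncomputable def unitization (I : ClosedIdeal A) : ClosedIdeal (Unitization ℂ A) where
  toSubmodule := I.toSubmodule.map (Unitization.inrHom ℂ ℂ A : A →ₗ[ℂ] Unitization ℂ A)
  mul_mem_left' := by
    rintro a _ ⟨y, hy, rfl⟩
    refine ⟨a.fst • y + a.snd * y, I.add_mem (I.smul_mem _ hy) (I.mul_mem_left _ hy), ?_⟩
    ext <;> simp
  mul_mem_right' := by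
    rintro a _ ⟨y, hy, rfl⟩
    refine ⟨a.fst • y + y * a.snd, I.add_mem (I.smul_mem _ hy) (I.mul_mem_right _ hy), ?_⟩
    ext <;> simp
  isClosed' :=
    (Unitization.isometry_inr (𝕜 := ℂ) (A := A)).isClosedEmbedding.isClosedMap _ I.isClosed

theorem inr_mem_unitization {I : ClosedIdeal A} {y : A} :
    (y : Unitization ℂ A) ∈ I.unitization ↔ y ∈ I :=
  ⟨fun ⟨_, hz, hzy⟩ => Unitization.inr_injective hzy ▸ hz, fun hy => ⟨y, hy, rfl⟩⟩

/-- The kernel of a *-homomorphism, as a closed ideal. -/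
def ker {B : Type v} [NonUnitalCStarAlgebra B] (π : A →⋆ₙₐ[ℂ] B) : ClosedIdeal A where
  toSubmodule := LinearMap.ker (π : A →ₗ[ℂ] B)
  mul_mem_left' a x hx := by
    change π (a * x) = 0
    rw [map_mul, show π x = 0 from hx, mul_zero]
  mul_mem_right' a x hx := by
    change π (x * a) = 0
    rw [map_mul, show π x = 0 from hx, zero_mul]
  isClosed' := isClosed_singleton.preimage (f := π) (map_continuous π)

theorem mem_ker {B : Type v} [NonUnitalCStarAlgebra B] {π : A →⋆ₙₐ[ℂ] B} {x : A} :
    x ∈ ker π ↔ π x = 0 := Iff.rfl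

end ClosedIdeal

variable {A : Type u} [NonUnitalCStarAlgebra A]

theorem isIrreducibleRep_comp_inr {H : Type v} [NormedAddCommGroup H] [InnerProductSpace ℂ H]
    [CompleteSpace H] {π : Unitization ℂ A →⋆ₐ[ℂ] (H →L[ℂ] H)} (hne : ∃ a : A, π a ≠ 0)
    (hirr : ∀ K : Submodule ℂ H, IsClosed (K : Set H) → (∀ b, ∀ η ∈ K, π b η ∈ K) →
      K = ⊥ ∨ K = ⊤) :
    IsIrreducibleRep ((π : Unitization ℂ A →⋆ₙₐ[ℂ] (H →L[ℂ] H)).comp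
      (Unitization.inrNonUnitalStarAlgHom ℂ A)) := by
  refine ⟨hne, fun K hclosed hK => hirr K hclosed fun b η hη => ?_⟩
  induction b using Unitization.ind with
  | inl_add_inr r a =>
    rw [map_add, add_apply, ← Unitization.algebraMap_eq_inl, AlgHomClass.commutes]
    exact K.add_mem (K.smul_mem r hη) (hK a η hη)

theorem exists_isPrimitive_le_notMem (I : ClosedIdeal A) {x : A} (hx : x ∉ I) :
    ∃ P : ClosedIdeal A, P.IsPrimitive ∧ I ≤ P ∧ x ∉ P := by
  let := CStarAlgebra.spectralOrder (Unitization ℂ A)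
  have := CStarAlgebra.spectralOrderedRing (Unitization ℂ A)
  obtain ⟨f, hpure, hfI, hfx⟩ :=
    exists_isPure_apply_ne_zero I.unitization (mt ClosedIdeal.inr_mem_unitization.1 hx)
  let π := f.gnsStarAlgHom
  let ξ : f.GNS := (f.toPreGNS 1 : f.PreGNS)
  have hcyc : DenseRange fun b => π b ξ := denseRange_gnsStarAlgHom_toPreGNS_one f
  have hf : vectorFunctional π ξ = f := vectorFunctional_gnsStarAlgHom f
  have hπx : π x ≠ 0 := fun h => hfx <| by
    rw [← hf, vectorFunctional_apply, map_mul, h, mul_zero, zero_apply, inner_zero_right]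
  have hπI := map_eq_zero_of_vectorFunctional_eq_zero hcyc (hf ▸ hfI)
  have hirr := isIrreducibleRep_comp_inr ⟨x, hπx⟩ fun K hclosed hK =>
    eq_bot_or_eq_top_of_isPure hcyc (hf.symm ▸ hpure) hclosed hK
  exact ⟨.ker _, ⟨f.GNS, _, _, _, _, hirr, fun _ => ClosedIdeal.mem_ker⟩,
    fun y hy => hπI y (ClosedIdeal.inr_mem_unitization.2 hy), hπx⟩

end Primitive

section PrimitiveIdealSpace

namespace Prim

variable {A : Type u} [NonUnitalCStarAlgebra A]

/-- The complement of the hull of a closed ideal, as an open subset of `Prim A`; `coHull` is the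
inverse of the map `Φ_A`. -/
def coHull (I : ClosedIdeal A) : Opens (Prim A) where
  carrier := (hull I)ᶜ
  is_open' := ⟨I, (compl_compl _).symm⟩

theorem notMem_coHull {I : ClosedIdeal A} {P : Prim A} : P ∉ coHull I ↔ I ≤ P.1 := not_not

theorem coHull_surjective : Function.Surjective (coHull (A := A)) := fun G =>
  let ⟨I, hI⟩ := G.isOpen
  ⟨I, Opens.ext (compl_eq_comm.1 hI.symm)⟩

theorem coHull_mono {I J : ClosedIdeal A} (h : I ≤ J) : coHull I ≤ coHull J :=
  fun _ hI hJ => hI (h.trans hJ)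

end Prim

variable {A : Type u} [NonUnitalCStarAlgebra A]

theorem primAction_coHull (I : ClosedIdeal A) : primAction A (Prim.coHull I) = I := by
  refine le_antisymm (fun x hx => ?_) (le_sInf ?_)
  · by_contra hxI
    obtain ⟨P, hP, hIP, hxP⟩ := exists_isPrimitive_le_notMem I hxI
    exact hxP (ClosedIdeal.mem_sInf.1 hx P ⟨⟨P, hP⟩, Prim.notMem_coHull.2 hIP, rfl⟩)
  · rintro _ ⟨P, hP, rfl⟩
    exact Prim.notMem_coHull.1 hP

theorem coHull_primAction (G : Opens (Prim A)) : Prim.coHull (primAction A G) = G := by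
  obtain ⟨I, rfl⟩ := Prim.coHull_surjective G
  rw [primAction_coHull]

variable (A) in
/-- The map `Φ_A`, as an order isomorphism from the open subsets of `Prim A` to the closed ideals
of `A`. -/
def primOrderIso : Opens (Prim A) ≃o ClosedIdeal A :=
  .ofHomInv (primAction A) ⟨Prim.coHull, fun _ _ => Prim.coHull_mono⟩
    (OrderHom.ext _ _ (funext primAction_coHull)) (OrderHom.ext _ _ (funext coHull_primAction))

theorem primOrderIso_apply (G : Opens (Prim A)) : primOrderIso A G = primAction A G := rfl

theorem primAction_iSup {ι : Sort*} (G : ι → Opens (Prim A)) :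
    primAction A (⨆ i, G i) = ⨆ i, primAction A (G i) :=
  (primOrderIso A).map_iSup G

/-- The smallest open subset `U` of `Prim A` such that `x` lies in `Φ_A U`: the set of primitive
ideals that do not contain `x`. -/
def Prim.support (x : A) : Opens (Prim A) := coHull (.gen A x)

theorem primAction_support (x : A) : primAction A (Prim.support x) = .gen A x :=
  primAction_coHull _

theorem mem_primAction_iff {x : A} {U : Opens (Prim A)} :
    x ∈ primAction A U ↔ Prim.support x ≤ U := by
  rw [← ClosedIdeal.gen_le_iff, ← primAction_support]
  exact (primOrderIso A).le_iff_le

variable {D : Type u} {E : Type v} [NonUnitalCStarAlgebra D] [NonUnitalCStarAlgebra E]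

theorem mem_pullbackAction_iff {φ : D →⋆ₙₐ[ℂ] E} {d : D} {U : Opens (Prim E)} :
    d ∈ pullbackAction φ U ↔ Prim.support (φ d) ≤ U := mem_primAction_iff

theorem pullbackAction_sInf (φ : D →⋆ₙₐ[ℂ] E) (S : Set (Opens (Prim E))) :
    pullbackAction φ (sInf S) = sInf (pullbackAction φ '' S) := by
  refine SetLike.ext fun d => ?_
  simp only [mem_pullbackAction_iff, ClosedIdeal.mem_sInf, Set.forall_mem_image, le_sInf_iff]

theorem isSmallestSupport_pullbackAction_iff {φ : D →⋆ₙₐ[ℂ] E} {d : D} {U : Opens (Prim E)} :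
    IsSmallestSupport (pullbackAction φ) d U ↔ U = Prim.support (φ d) := by
  have h : IsLeast {V | d ∈ pullbackAction φ V} (Prim.support (φ d)) :=
    ⟨mem_pullbackAction_iff.2 le_rfl, fun _ => mem_pullbackAction_iff.1⟩
  exact ⟨fun hU => hU.unique h, fun hU => hU ▸ h⟩

theorem isXFull_pullbackAction_iff {φ ψ : D →⋆ₙₐ[ℂ] E} :
    IsXFull (pullbackAction φ) (primAction E) ψ ↔
      ∀ d, ClosedIdeal.gen E (ψ d) = ClosedIdeal.gen E (φ d) := by
  simp only [IsXFull, isSmallestSupport_pullbackAction_iff, exists_eq_left, primAction_support,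
    ClosedIdeal.isFullIn_iff_gen_eq]

theorem isEquivariant_pullbackAction_of_gen_eq {φ ψ : D →⋆ₙₐ[ℂ] E}
    (h : ∀ d, ClosedIdeal.gen E (ψ d) = ClosedIdeal.gen E (φ d)) :
    IsEquivariant (pullbackAction φ) (primAction E) ψ := by
  rintro U _ ⟨d, hd, rfl⟩
  rw [SetLike.mem_coe, ← ClosedIdeal.gen_le_iff, h, ClosedIdeal.gen_le_iff]
  exact hd

theorem isEquivariant_and_isXFull_pullbackAction_iff {φ ψ : D →⋆ₙₐ[ℂ] E} :
    IsEquivariant (pullbackAction φ) (primAction E) ψ ∧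
        IsXFull (pullbackAction φ) (primAction E) ψ ↔
      ∀ d, ClosedIdeal.gen E (ψ d) = ClosedIdeal.gen E (φ d) := by
  rw [isXFull_pullbackAction_iff, and_iff_right_of_imp isEquivariant_pullbackAction_of_gen_eq]

end PrimitiveIdealSpace

section DirectedSuprema

/-- The function `t ↦ t - r` for `t ≥ r`, `t ↦ t + r` for `t ≤ -r` and zero in between. -/
def softThreshold (r t : ℝ) : ℝ := t - max (-r) (min t r)

theorem continuous_softThreshold (r : ℝ) : Continuous (softThreshold r) := by
  unfold softThreshold
  fun_prop

theorem softThreshold_eq_zero {r t : ℝ} (h : |t| ≤ r) : softThreshold r t = 0 := by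
  rw [softThreshold, min_eq_left (abs_le.1 h).2, max_eq_right (abs_le.1 h).1, sub_self]

theorem softThreshold_zero {r : ℝ} (hr : 0 ≤ r) : softThreshold r 0 = 0 :=
  softThreshold_eq_zero (abs_zero.trans_le hr)

theorem abs_sub_softThreshold_le {r : ℝ} (hr : 0 ≤ r) (t : ℝ) : |t - softThreshold r t| ≤ r := by
  rw [softThreshold, sub_sub_cancel, abs_le]
  exact ⟨le_max_left _ _, max_le (by linarith) (min_le_right _ _)⟩

variable {A : Type u} [NonUnitalCStarAlgebra A]

theorem cfcₙ_softThreshold_eq_zero {a : A} (ha : IsSelfAdjoint a) {r : ℝ} (har : ‖a‖ ≤ r) :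
    cfcₙ (softThreshold r) a = 0 :=
  norm_le_zero_iff.1 <| norm_cfcₙ_le fun _ ht => norm_le_zero_iff.2 <| softThreshold_eq_zero <|
    (NonUnitalIsometricContinuousFunctionalCalculus.norm_quasispectrum_le a ht ha).trans har

theorem norm_sub_cfcₙ_softThreshold_le {a : A} (ha : IsSelfAdjoint a) {r : ℝ} (hr : 0 ≤ r) :
    ‖a - cfcₙ (softThreshold r) a‖ ≤ r := by
  have h : a - cfcₙ (softThreshold r) a = cfcₙ (fun t => t - softThreshold r t) a := by
    have hcont := continuous_softThreshold r
    have hzero := softThreshold_zero hr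
    rw [cfcₙ_sub .., cfcₙ_id' ℝ a]
  exact h ▸ norm_cfcₙ_le fun t _ => abs_sub_softThreshold_le hr t

theorem map_cfcₙ_softThreshold {B : Type v} [NonUnitalCStarAlgebra B] (φ : A →⋆ₙₐ[ℂ] B) {a : A}
    (ha : IsSelfAdjoint a) {r : ℝ} (hr : 0 ≤ r) :
    φ (cfcₙ (softThreshold r) a) = cfcₙ (softThreshold r) (φ a) := by
  have hcont := continuous_softThreshold r
  have hzero := softThreshold_zero hr
  have hφa := ha.map φ
  exact NonUnitalStarAlgHomClass.map_cfcₙ φ _ a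

namespace ClosedIdeal

theorem cfcₙ_softThreshold_mem {I : ClosedIdeal A} {a y : A} (ha : IsSelfAdjoint a) (hy : y ∈ I) :
    cfcₙ (softThreshold ‖a - y‖) a ∈ I := by
  by_contra hmem
  obtain ⟨P, ⟨H, _, _, _, π, -, hker⟩, hIP, hP⟩ := exists_isPrimitive_le_notMem I hmem
  have hπa : ‖π a‖ ≤ ‖a - y‖ := calc
    ‖π a‖ = ‖π (a - y)‖ := by rw [map_sub, (hker y).1 (hIP hy), sub_zero]
    _ ≤ ‖a - y‖ := NonUnitalStarAlgHom.norm_apply_le π _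
  refine hP ((hker _).2 ?_)
  rw [map_cfcₙ_softThreshold π ha (norm_nonneg _)]
  exact cfcₙ_softThreshold_eq_zero (ha.map π) hπa

theorem mem_iSup_of_directed {ι : Type*} [Nonempty ι] {J : ι → ClosedIdeal A}
    (hJ : Directed (· ≤ ·) J) {x : A} : x ∈ ⨆ i, J i ↔ x ∈ closure (⋃ i, (J i : Set A)) := by
  have h : (⨆ I ∈ Set.range J, I.toSubmodule) = ⨆ i, (J i).toSubmodule := iSup_range
  change x ∈ (⨆ I ∈ Set.range J, I.toSubmodule).topologicalClosure ↔ _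
  rw [h, ← SetLike.mem_coe, Submodule.topologicalClosure_coe, Submodule.coe_iSup_of_directed _ hJ]
  rfl

variable {B : Type v} [NonUnitalCStarAlgebra B]

theorem comap_mono (φ : A →⋆ₙₐ[ℂ] B) : Monotone (comap φ) := fun _ _ h _ hx => h hx

theorem exists_mem_comap_norm_sub_le (φ : A →⋆ₙₐ[ℂ] B) {I : ClosedIdeal B} {a : A}
    (ha : IsSelfAdjoint a) {y : B} (hy : y ∈ I) : ∃ b ∈ comap φ I, ‖a - b‖ ≤ ‖φ a - y‖ := by
  refine ⟨cfcₙ (softThreshold ‖φ a - y‖) a, ?_, norm_sub_cfcₙ_softThreshold_le ha (norm_nonneg _)⟩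
  change φ _ ∈ I
  rw [map_cfcₙ_softThreshold φ ha (norm_nonneg _)]
  exact cfcₙ_softThreshold_mem (ha.map φ) hy

theorem comap_iSup_of_directed (φ : A →⋆ₙₐ[ℂ] B) {ι : Type*} [Nonempty ι] {J : ι → ClosedIdeal B}
    (hJ : Directed (· ≤ ·) J) : comap φ (⨆ i, J i) = ⨆ i, comap φ (J i) := by
  refine le_antisymm (fun x hx => mem_of_star_mul_self_mem _ ?_) (comap_mono φ).le_map_iSup
  have hxx : φ (star x * x) ∈ ⨆ i, J i := (comap φ _).mul_mem_left (star x) hx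
  have hdir : Directed (· ≤ ·) fun i => comap φ (J i) := .mono_comp (· ≤ ·) (comap_mono φ) hJ
  rw [mem_iSup_of_directed hJ, Metric.mem_closure_iff] at hxx
  rw [mem_iSup_of_directed hdir, Metric.mem_closure_iff]
  intro ε hε
  obtain ⟨y, hy, hxy⟩ := hxx ε hε
  obtain ⟨i, hi⟩ := Set.mem_iUnion.1 hy
  obtain ⟨b, hb, hxb⟩ := exists_mem_comap_norm_sub_le φ (.star_mul_self x) hi
  rw [dist_eq_norm] at hxy
  exact ⟨b, Set.mem_iUnion.2 ⟨i, hb⟩, (dist_eq_norm _ b).trans_lt (hxb.trans_lt hxy)⟩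

end ClosedIdeal

theorem pullbackAction_iSup_of_directed {B : Type v} [NonUnitalCStarAlgebra B] (φ : A →⋆ₙₐ[ℂ] B)
    {ι : Type*} [Nonempty ι] {G : ι → Opens (Prim B)} (hG : Directed (· ≤ ·) G) :
    pullbackAction φ (⨆ i, G i) = ⨆ i, pullbackAction φ (G i) := by
  change ClosedIdeal.comap φ (primAction B (⨆ i, G i)) = _
  rw [primAction_iSup]
  exact ClosedIdeal.comap_iSup_of_directed φ (.mono_comp (· ≤ ·) (primAction B).monotone hG)

end DirectedSuprema

end CStarX

theorem mainTheorem11_general {D : Type*} {E : Type*}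
    [NonUnitalCStarAlgebra D] [NonUnitalCStarAlgebra E] (φ : D →⋆ₙₐ[ℂ] E) :
    (∃ e : TopologicalSpace.Opens (CStarX.Prim E) ≃o CStarX.ClosedIdeal E,
      ∀ G, e G = CStarX.primAction E G) ∧
    (∀ S : Set (TopologicalSpace.Opens (CStarX.Prim E)),
      CStarX.pullbackAction φ (sInf S) = sInf (CStarX.pullbackAction φ '' S)) ∧
    (∀ (I : Type*) [Preorder I] [IsDirectedOrder I] [Nonempty I]
      (G : I → TopologicalSpace.Opens (CStarX.Prim E)), Monotone G →
      CStarX.pullbackAction φ (⨆ i, G i) = ⨆ i, CStarX.pullbackAction φ (G i)) ∧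
    (∀ d : D, ∃ U : TopologicalSpace.Opens (CStarX.Prim E),
      CStarX.IsSmallestSupport (CStarX.pullbackAction φ) d U) ∧
    (CStarX.IsEquivariant (CStarX.pullbackAction φ) (CStarX.primAction E) φ ∧
      CStarX.IsXFull (CStarX.pullbackAction φ) (CStarX.primAction E) φ) ∧
    (∀ ψ : D →⋆ₙₐ[ℂ] E,
      (∀ a : D, CStarX.ClosedIdeal.gen E (ψ a) = CStarX.ClosedIdeal.gen E (φ a)) ↔
        (CStarX.IsEquivariant (CStarX.pullbackAction φ) (CStarX.primAction E) ψ ∧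
          CStarX.IsXFull (CStarX.pullbackAction φ) (CStarX.primAction E) ψ)) :=
  ⟨⟨CStarX.primOrderIso E, CStarX.primOrderIso_apply⟩,
    CStarX.pullbackAction_sInf φ,
    fun _ _ _ _ _ hG => CStarX.pullbackAction_iSup_of_directed φ hG.directed_le,
    fun _ => ⟨_, CStarX.isSmallestSupport_pullbackAction_iff.2 rfl⟩,
    CStarX.isEquivariant_and_isXFull_pullbackAction_iff.2 fun _ => rfl,
    fun _ => CStarX.isEquivariant_and_isXFull_pullbackAction_iff.symm⟩

theorem mainTheorem11 {D : Type*} {E : Type*}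
    [NonUnitalCStarAlgebra D] [NonUnitalCStarAlgebra E] (φ : D →⋆ₙₐ[ℂ] E) :
    -- (1)
    (∃ e : TopologicalSpace.Opens (CStarX.Prim E) ≃o CStarX.ClosedIdeal E,
      ∀ G, e G = CStarX.primAction E G) ∧
    -- (2)
    (∀ S : Set (TopologicalSpace.Opens (CStarX.Prim E)),
      CStarX.pullbackAction φ (sInf S) = sInf (CStarX.pullbackAction φ '' S)) ∧
    (Finite (TopologicalSpace.Opens (CStarX.Prim E)) →
      ∀ (I : Type*) [Preorder I] [IsDirectedOrder I] [Nonempty I]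
        (G : I → TopologicalSpace.Opens (CStarX.Prim E)), Monotone G →
        CStarX.pullbackAction φ (⨆ i, G i) = ⨆ i, CStarX.pullbackAction φ (G i)) ∧
    -- (3)
    (∀ d : D, ∃ U : TopologicalSpace.Opens (CStarX.Prim E),
      CStarX.IsSmallestSupport (CStarX.pullbackAction φ) d U) ∧
    -- (4)
    (CStarX.IsEquivariant (CStarX.pullbackAction φ) (CStarX.primAction E) φ ∧
      CStarX.IsXFull (CStarX.pullbackAction φ) (CStarX.primAction E) φ) ∧
    -- (5)
    (∀ ψ : D →⋆ₙₐ[ℂ] E,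
      (∀ a : D, CStarX.ClosedIdeal.gen E (ψ a) = CStarX.ClosedIdeal.gen E (φ a)) ↔
        (CStarX.IsEquivariant (CStarX.pullbackAction φ) (CStarX.primAction E) ψ ∧
          CStarX.IsXFull (CStarX.pullbackAction φ) (CStarX.primAction E) ψ)) :=
  let ⟨h_iso, h_sInf, h_iSup, h_rest⟩ := mainTheorem11_general φ
  ⟨h_iso, h_sInf, fun _ => h_iSup, h_rest⟩
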